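/- Conventions. A polytope is the convex hull of a finite non-empty set of points. A face of a polytope $\Delta$ is a non-empty set $F=\Delta\cap\{L=\lambda\}$, where $L$ is a linear functional (possibly zero, so that $\Delta$ is a face of itself) with $L|_\Delta\ge\lambda$; its dimension is that of its affine span, and a facet is a face of codimension one. $\Delta$ is simple if every face of codimension $k$ is contained in at most $k$ facets. $\operatorname{relint}(F)$ is the interior of $F$ in its affine span. A function on $\Delta\subset\mathbb R^n$ is smooth if near each point of $\Delta$ it has a smooth extension to an open subset of $\mathbb R^n$. Proposition. Let $\Delta\subset\mathbb{R}^n$ be an $n$-dimensional simple polytope. Then there is a smooth function $f\colon\Delta\to\mathbb{R}$ with the following properties (A) and (C). (A) For every face $F$ of $\Delta$, the minimum of $f$ on $F$ is attained at exactly one point $x_F$ of $F$; this point lies in $\operatorname{relint}(F)$, and it is the one and only critical point of $f|_{\operatorname{relint}(F)}$. (C) For every face $F$ of $\Delta$, of dimension $\ell$ say, there exist $\varepsilon>0$, a neighbourhood $U$ of $x_F$ in $\Delta$, and affine coordinates $(x_1,\dots,x_\ell,y_1,\dots,y_{n-\ell})$ on $\mathbb R^n$ such that $x_F$ is the origin,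 $U$ is given by $(-\varepsilon,\varepsilon)^\ell\times[0,\varepsilon)^{n-\ell}$, $F\cap U$ is given in $U$ by $y_1=\dots=y_{n-\ell}=0$, and on $U$ $$f=a\Big(\sum_{j=1}^{\ell}x_j^2-\sum_{j=1}^{n-\ell}y_j\Big)+b$$ for some constants $a>0$ and $b\in\mathbb R$. (B) Moreover, suppose that for each face $F$ of $\Delta$ we are given a point $x_F\in\operatorname{relint}(F)$ and a number $\alpha_F\in\mathbb R_{\ge0}$, such that $\alpha_F<\alpha_{F'}$ whenever $F'$ is a proper subface of $F$. Then there is a smooth function $f\colon\Delta\to\mathbb{R}$ that satisfies (A) and (C) with these points $x_F$ and in addition $f(x_F)=\alpha_F$ for every face $F$. -/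

import Mathlib

open Set Topology
open scoped ContDiff

section Polytopes

variable {E : Type*} [NormedAddCommGroup E] [NormedSpace ℝ E]

/-- A polytope: the convex hull of a finite non-empty set of points. -/
def IsPolytope (Δ : Set E) : Prop :=
  ∃ s : Finset E, s.Nonempty ∧ Δ = convexHull ℝ (s : Set E)

/-- The dimension of a set: the dimension of its affine span (used for non-empty sets). -/
noncomputable def affDim (X : Set E) : ℕ :=
  Module.finrank ℝ (affineSpan ℝ X).direction

/-- A (non-empty) face: the intersection of `Δ` with a supporting hyperplane, that is, the set
where some linear functional attains its extremum over `Δ`. The functional may be zero, so `Δ`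
is a face of itself. -/
def IsFace (Δ F : Set E) : Prop :=
  F.Nonempty ∧ IsExposed ℝ Δ F

/-- A facet: a face of codimension one. -/
def IsFacet (Δ G : Set E) : Prop :=
  IsFace Δ G ∧ affDim G + 1 = affDim Δ

/-- A simple polytope: every face of codimension `k` is contained in no more than `k` facets. -/
def IsSimplePolytope (Δ : Set E) : Prop :=
  IsPolytope Δ ∧
    ∀ F : Set E, IsFace Δ F →
      {G : Set E | IsFacet Δ G ∧ F ⊆ G}.encard ≤ ((affDim Δ - affDim F : ℕ) : ℕ∞)

/-- Smoothness of a function on an arbitrary subset `X`: near each point of `X` there is a smooth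
extension to an open set. It depends only on the values of `f` on `X`. -/
def IsSmoothOnSet (f : E → ℝ) (X : Set E) : Prop :=
  ∀ x ∈ X, ∃ U : Set E, IsOpen U ∧ x ∈ U ∧
    ∃ g : E → ℝ, ContDiffOn ℝ ∞ g U ∧ EqOn g f (U ∩ X)

/-- For `p` in the relative interior of `F`: `p` is a critical point of the restriction of `f` to
the relative interior of `F`, i.e. the differential of this restriction (a function near `p` on
the affine span of `F`, here translated to its direction) exists and vanishes at `p`. -/
def IsCriticalOnRelint (f : E → ℝ) (F : Set E) (p : E) : Prop :=
  HasFDerivAt (fun v : (affineSpan ℝ F).direction => f ((v : E) + p))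
    (0 : (affineSpan ℝ F).direction →L[ℝ] ℝ) 0

/-- The minimum of `f` on `F` is attained exactly at `p`, which lies in the relative interior of
`F`, and `p` is the one and only critical point of the restriction of `f` to the relative
interior of `F`. -/
def HasUniqueCriticalMinAt (f : E → ℝ) (F : Set E) (p : E) : Prop :=
  p ∈ intrinsicInterior ℝ F ∧
    (∀ q ∈ F, q ≠ p → f p < f q) ∧
    IsCriticalOnRelint f F p ∧
    ∀ q ∈ intrinsicInterior ℝ F, IsCriticalOnRelint f F q → q = p

/-- The local normal form of `f` at the point `p` of a face `F` of `Δ`, with `ℓ = dim F` and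
`n = dim Δ = dim E`: there are affine coordinates `(x, y)` centred at `p` in which a neighbourhood
`U` of `p` in `Δ` is `(-ε, ε)^ℓ × [0, ε)^(n - ℓ)`, in which `F` is given on `U` by `y = 0`, and in
which `f` is, up to a positive factor and an additive constant, `∑ x_j ^ 2 - ∑ y_j` on `U`. -/
def HasNormalFormAt (Δ : Set E) (f : E → ℝ) (F : Set E) (p : E) : Prop :=
  ∃ ε : ℝ, 0 < ε ∧
  ∃ e : E ≃ᵃ[ℝ] (Fin (affDim F) → ℝ) × (Fin (affDim Δ - affDim F) → ℝ),
  ∃ U : Set E, U ⊆ Δ ∧ U ∈ 𝓝[Δ] p ∧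
    e p = 0 ∧
    e '' U = {z | (∀ j, z.1 j ∈ Ioo (-ε) ε) ∧ ∀ j, z.2 j ∈ Ico 0 ε} ∧
    U ∩ F = {q ∈ U | (e q).2 = 0} ∧
    ∃ a b : ℝ, 0 < a ∧
      ∀ q ∈ U, f q = a * (∑ j, (e q).1 j ^ 2 - ∑ j, (e q).2 j) + b

end Polytopes

/-! ### Smooth approximations of the maximum. -/

section RegularizedMax

/-! Attach to each face `F` the model `h F = α F + δ Q F - κ Y F`. Here `Q F` is a sum of squares of
linear coordinates vanishing at `x F` and injective along `F`, and `Y F` is the sum of `c G - l G`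
over the facets `G` containing `F`, so that `Y F` is zero on `F` and positive on the rest of `Δ`.
The function `f` is a regularized maximum of all the `h F`, with `δ` small and `κ` large. Its
differential is a convex combination of the differentials of the models that are maximal up to `δ`.

The key claim is that on a face `F'` only faces `F ⊆ F'` are active. If `F` misses `F'`, a large `κ`
suppresses `h F`. If `F` meets `F'` without lying in it, simplicity enters: a facet containing `F ∩
F'` contains `F` or `F'` (`subset_or_subset`), so `Y (F ∩ F') = Y F` on `F'`, and `α (F ∩ F') > α F`
makes `h (F ∩ F')` win. For the active faces, the derivative of `h F` at `q ∈ F'` in the direction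
`q - x F'` is positive when `q ≠ x F'`. Hence `f` increases along the rays of `F'` from `x F'`,
which gives the unique minimum and critical point (`hasUniqueCriticalMinAt_of_radial`).

Near `x F'` the model `h F'` beats all others by more than `δ`, so `f = h F'` there. In a simple
polytope the functionals of the facets through `F'` are independent and equal in number to the
codimension, so they complete the coordinates along `F'` to affine coordinates in which `h F'` is
the normal form. -/

/-- A smoothing of `max 0`: nondecreasing, 1-Lipschitz, equal to `max 0` away from `(-τ, τ)`. -/
theorem exists_smooth_posPart {τ : ℝ} (hτ : 0 < τ) :
    ∃ χ : ℝ → ℝ, ContDiff ℝ ∞ χ ∧ (∀ u, 0 ≤ deriv χ u) ∧ (∀ u, deriv χ u ≤ 1) ∧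
      (∀ u ≤ -τ, χ u = 0) ∧ (∀ u, τ ≤ u → χ u = u) := by
  set g : ℝ → ℝ := fun u => ∫ t in (0 : ℝ)..u, Real.smoothTransition t with hg
  have hc : Continuous Real.smoothTransition := Real.smoothTransition.continuous
  have hd : ∀ u, HasDerivAt g (Real.smoothTransition u) u := fun u =>
    intervalIntegral.integral_hasDerivAt_right (hc.intervalIntegrable _ _)
      hc.aestronglyMeasurable.stronglyMeasurableAtFilter hc.continuousAt
  have hsm : ContDiff ℝ ∞ g := by
    rw [contDiff_infty_iff_deriv]
    refine ⟨fun u => (hd u).differentiableAt, ?_⟩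
    rw [show deriv g = Real.smoothTransition from funext fun u => (hd u).deriv]
    exact Real.smoothTransition.contDiff
  have h0 : ∀ u ≤ 0, g u = 0 := by
    intro u hu
    simp only [hg]
    rw [intervalIntegral.integral_congr (g := fun _ => (0 : ℝ)), intervalIntegral.integral_zero]
    intro t ht
    rw [uIcc_of_ge hu] at ht
    exact Real.smoothTransition.zero_of_nonpos ht.2
  have h1 : ∀ u, 1 ≤ u → g u = g 1 + (u - 1) := by
    intro u hu
    simp only [hg]
    rw [← intervalIntegral.integral_add_adjacent_intervals
      (hc.intervalIntegrable 0 1) (hc.intervalIntegrable 1 u)]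
    congr 1
    rw [intervalIntegral.integral_congr (g := fun _ => (1 : ℝ))]
    · simp
    intro t ht
    rw [uIcc_of_le hu] at ht
    exact Real.smoothTransition.one_of_one_le ht.1
  have hg0 : 0 ≤ g 1 :=
    intervalIntegral.integral_nonneg zero_le_one fun t _ => Real.smoothTransition.nonneg t
  have hg1 : g 1 ≤ 1 := by
    have := intervalIntegral.integral_mono_on (a := 0) (b := 1) (μ := MeasureTheory.volume)
      zero_le_one (hc.intervalIntegrable 0 1) (continuous_const.intervalIntegrable 0 1)
      (fun t _ => Real.smoothTransition.le_one t)
    simpa using this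
  -- For arguments at least `1`, `g` is the identity shifted by `g 1 - 1`; the translation by `1 - g
  -- 1` cancels this. Since `0 ≤ g 1 ≤ 1`, the transition remains within `|u| ≤ τ` after rescaling.
  have hχ : ∀ u, HasDerivAt (fun u => τ * g (u / τ + (1 - g 1)))
      (Real.smoothTransition (u / τ + (1 - g 1))) u := by
    intro u
    have h2 : HasDerivAt (fun u : ℝ => u / τ + (1 - g 1)) (1 / τ) u :=
      ((hasDerivAt_id u).div_const τ).add_const _
    have h3 := ((hd (u / τ + (1 - g 1))).comp u h2).const_mul τ
    exact h3.congr_deriv (by field_simp)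
  refine ⟨fun u => τ * g (u / τ + (1 - g 1)), ?_, ?_, ?_, ?_, ?_⟩
  · exact contDiff_const.mul (hsm.comp ((contDiff_id.div_const τ).add contDiff_const))
  · intro u
    rw [(hχ u).deriv]
    exact Real.smoothTransition.nonneg _
  · intro u
    rw [(hχ u).deriv]
    exact Real.smoothTransition.le_one _
  · intro u hu
    have : u / τ ≤ -1 := by rw [div_le_iff₀ hτ]; linarith
    simp only
    rw [h0 _ (by linarith), mul_zero]
  · intro u hu
    have : 1 ≤ u / τ := by rw [le_div_iff₀ hτ]; linarith
    simp only
    rw [h1 _ (by linarith)]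
    field_simp
    ring

variable {E : Type*} [NormedAddCommGroup E] [NormedSpace ℝ E]

/-- A regularized maximum of finitely many smooth functions: its differential is a convex
combination of the differentials of the functions which are maximal up to `σ`. -/
theorem exists_regularized_max {ι : Type*} (s : Finset ι) (hs : s.Nonempty) (h : ι → E → ℝ)
    (hh : ∀ i ∈ s, ContDiff ℝ ∞ (h i)) {σ : ℝ} (hσ : 0 < σ) :
    ∃ f : E → ℝ, ContDiff ℝ ∞ f ∧ (∀ q, ∀ i ∈ s, h i q ≤ f q) ∧
      (∀ q, ∃ i ∈ s, f q ≤ h i q + σ) ∧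
      (∀ q, ∃ w : ι → ℝ, (∀ i ∈ s, 0 ≤ w i) ∧ ∑ i ∈ s, w i = 1 ∧
        fderiv ℝ f q = ∑ i ∈ s, w i • fderiv ℝ (h i) q ∧
        ∀ i ∈ s, w i ≠ 0 → f q ≤ h i q + σ) ∧
      (∀ q, ∀ i ∈ s, (∀ j ∈ s, j ≠ i → h j q + σ < h i q) → f q = h i q) := by
  classical
  induction hs using Finset.Nonempty.cons_induction generalizing σ with
  | singleton a =>
    refine ⟨h a, hh a (by simp), by simp, by simp [hσ.le], ?_, by simp⟩
    intro q
    exact ⟨fun _ => 1, by simp, by simp, by simp, by simp [hσ.le]⟩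
  | cons a s ha hs ih =>
    -- Errors add: half of the tolerance goes to the inductive maximum, half to the new smoothing.
    have hτ : 0 < σ / 2 := half_pos hσ
    obtain ⟨f, hf, hle, hge, hw, heq⟩ := ih (fun i hi => hh i (by simp [hi])) hτ
    obtain ⟨χ, hχ, hχ0, hχ1, hχn, hχp⟩ := exists_smooth_posPart hτ
    have hk : ContDiff ℝ ∞ (h a) := hh a (by simp)
    have hχd : Differentiable ℝ χ := hχ.differentiable (by simp)
    have hmono : Monotone χ := monotone_of_deriv_nonneg hχd hχ0
    have hanti : Antitone fun u => χ u - u := by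
      refine antitone_of_deriv_nonpos (hχd.sub differentiable_id) fun u => ?_
      have hdu : HasDerivAt (fun u => χ u - u) (deriv χ u - 1) u :=
        (hχd u).hasDerivAt.sub (hasDerivAt_id u)
      rw [hdu.deriv]
      linarith [hχ1 u]
    have hnn : ∀ u, 0 ≤ χ u := fun u => by
      rw [← hχn (min u (-(σ / 2))) (min_le_right _ _)]
      exact hmono (min_le_left _ _)
    have hge_id : ∀ u, u ≤ χ u := fun u => by
      have h1 := hanti (le_max_left u (σ / 2))
      simp only at h1
      rw [hχp (max u (σ / 2)) (le_max_right _ _)] at h1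
      linarith
    have hup1 : ∀ u ≤ σ / 2, χ u ≤ σ / 2 := fun u hu => by
      have := hmono hu
      rwa [hχp _ le_rfl] at this
    have hup2 : ∀ u, -(σ / 2) ≤ u → χ u ≤ u + σ / 2 := fun u hu => by
      have := hanti hu
      simp only at this
      rw [hχn _ le_rfl] at this
      linarith
    -- Smoothed form of `max a b = b + max 0 (a - b)`. Its differential is `(1 - d) df + d dh_a`
    -- with `d = χ' ∈ [0, 1]`, which dictates the new weights.
    refine ⟨fun q => f q + χ (h a q - f q), hf.add (hχ.comp (hk.sub hf)), ?_, ?_, ?_, ?_⟩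
    · intro q i hi
      rcases Finset.mem_cons.1 hi with rfl | hi
      · linarith [hge_id (h i q - f q)]
      · linarith [hle q i hi, hnn (h a q - f q)]
    · intro q
      by_cases hq : h a q - f q ≤ σ / 2
      · obtain ⟨i, hi, hfi⟩ := hge q
        exact ⟨i, by simp [hi], by linarith [hup1 _ hq]⟩
      · exact ⟨a, by simp, by linarith [hup2 (h a q - f q) (by linarith)]⟩
    · intro q
      obtain ⟨w, hw0, hw1, hwd, hwa⟩ := hw q
      set d := deriv χ (h a q - f q) with hd
      have hane : ∀ i ∈ s, i ≠ a := fun i hi hia => ha (hia ▸ hi)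
      refine ⟨fun i => if i = a then d else (1 - d) * w i, ?_, ?_, ?_, ?_⟩
      · intro i hi
        rcases Finset.mem_cons.1 hi with rfl | hi
        · simp [hd, hχ0]
        · simp only [if_neg (hane i hi)]
          exact mul_nonneg (by linarith [hχ1 (h a q - f q)]) (hw0 i hi)
      · rw [Finset.sum_cons, if_pos rfl,
          Finset.sum_congr rfl fun i hi => if_neg (hane i hi), ← Finset.mul_sum, hw1]
        ring
      · have hfd : HasFDerivAt f (fderiv ℝ f q) q :=
          (hf.differentiable (by simp) q).hasFDerivAt
        have hkd : HasFDerivAt (h a) (fderiv ℝ (h a) q) q :=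
          (hk.differentiable (by simp) q).hasFDerivAt
        have hcomp := (hχd (h a q - f q)).hasDerivAt.comp_hasFDerivAt q (hkd.sub hfd)
        have htot := (hfd.add hcomp).fderiv
        rw [Finset.sum_cons]
        beta_reduce
        rw [if_pos rfl, Finset.sum_congr rfl fun i hi =>
          show (if i = a then d else (1 - d) * w i) • fderiv ℝ (h i) q
            = (1 - d) • (w i • fderiv ℝ (h i) q) by rw [if_neg (hane i hi), mul_smul],
          ← Finset.smul_sum, ← hwd]
        refine Eq.trans htot ?_
        rw [← hd, smul_sub, sub_smul, one_smul]
        abel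
      · intro i hi hne
        rcases Finset.mem_cons.1 hi with rfl | hi
        · simp only [if_true] at hne
          have : -(σ / 2) ≤ h i q - f q := by
            by_contra hlt
            push Not at hlt
            refine hne ?_
            have : χ =ᶠ[𝓝 (h i q - f q)] fun _ => 0 := by
              filter_upwards [Iio_mem_nhds hlt] with u hu using hχn u (le_of_lt hu)
            rw [hd, this.deriv_eq, deriv_const]
          linarith [hup2 _ this]
        · simp only [if_neg (hane i hi)] at hne
          have hwi : w i ≠ 0 := right_ne_zero_of_mul hne
          have hd1 : 1 - d ≠ 0 := left_ne_zero_of_mul hne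
          have : h a q - f q ≤ σ / 2 := by
            by_contra hlt
            push Not at hlt
            refine hd1 ?_
            have : χ =ᶠ[𝓝 (h a q - f q)] fun u => u := by
              filter_upwards [Ioi_mem_nhds hlt] with u hu using hχp u (le_of_lt hu)
            rw [hd, this.deriv_eq, deriv_id'', sub_self]
          linarith [hup1 _ this, hwa i hi hwi]
    · intro q i hi hlt
      rcases Finset.mem_cons.1 hi with rfl | hi
      · obtain ⟨j, hj, hfj⟩ := hge q
        have := hlt j (by simp [hj]) (fun hja => ha (hja ▸ hj))
        simp only
        rw [hχp _ (by linarith)]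
        ring
      · have hfi := heq q i hi fun j hj hne => by linarith [hlt j (by simp [hj]) hne]
        have := hlt a (by simp) (fun hia => ha (hia ▸ hi))
        simp only
        rw [hχn _ (by linarith), add_zero, hfi]

end RegularizedMax

/-! ### Faces, supporting functionals and relative interiors. -/

section FaceLattice

variable {E : Type*} [NormedAddCommGroup E] [NormedSpace ℝ E]

theorem IsFace.exists_support {Δ F : Set E} (hF : IsFace Δ F) :
    ∃ (l : E →L[ℝ] ℝ) (c : ℝ), (∀ q ∈ Δ, l q ≤ c) ∧ ∀ q, q ∈ F ↔ q ∈ Δ ∧ l q = c := by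
  obtain ⟨⟨p, hp⟩, hexp⟩ := hF
  obtain ⟨l, rfl⟩ := hexp ⟨p, hp⟩
  refine ⟨l, l p, hp.2, fun q => ⟨fun hq => ⟨hq.1, le_antisymm (hp.2 q hq.1) (hq.2 p hp.1)⟩,
    fun hq => ⟨hq.1, fun y hy => ?_⟩⟩⟩
  rw [hq.2]
  exact hp.2 y hy

theorem IsFace.of_support {Δ : Set E} {l : E →L[ℝ] ℝ} {c : ℝ} (hle : ∀ q ∈ Δ, l q ≤ c)
    (hne : ∃ q ∈ Δ, l q = c) : IsFace Δ {q ∈ Δ | l q = c} := by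
  obtain ⟨p, hp, hpc⟩ := hne
  refine ⟨⟨p, hp, hpc⟩, fun _ => ⟨l, Set.ext fun q => and_congr_right fun hq =>
    ⟨fun h y hy => h ▸ hle y hy, fun h => le_antisymm (hle q hq) (hpc ▸ h p hp)⟩⟩⟩

theorem IsFace.subset {Δ F : Set E} (hF : IsFace Δ F) : F ⊆ Δ := hF.2.subset

theorem IsFace.inter {Δ F F' : Set E} (hF : IsFace Δ F) (hF' : IsFace Δ F')
    (hne : (F ∩ F').Nonempty) : IsFace Δ (F ∩ F') :=
  ⟨hne, hF.2.inter hF'.2⟩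

theorem IsPolytope.isCompact {Δ : Set E} (hΔ : IsPolytope Δ) : IsCompact Δ := by
  obtain ⟨s, -, rfl⟩ := hΔ
  exact s.finite_toSet.isCompact_convexHull ℝ

theorem IsPolytope.convex {Δ : Set E} (hΔ : IsPolytope Δ) : Convex ℝ Δ := by
  obtain ⟨s, -, rfl⟩ := hΔ
  exact convex_convexHull ℝ _

theorem IsPolytope.nonempty {Δ : Set E} (hΔ : IsPolytope Δ) : Δ.Nonempty := by
  obtain ⟨s, hs, rfl⟩ := hΔ
  exact hs.to_set.convexHull

/-- A face is the convex hull of the vertices it contains, so there are finitely many faces. -/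
theorem IsPolytope.finite_faces {Δ : Set E} (hΔ : IsPolytope Δ) : {F | IsFace Δ F}.Finite := by
  have hfin : (Δ.extremePoints ℝ).Finite := by
    obtain ⟨s, -, rfl⟩ := hΔ
    exact s.finite_toSet.subset extremePoints_convexHull_subset
  refine Set.Finite.of_finite_image (f := fun F => F ∩ Δ.extremePoints ℝ)
    (hfin.finite_subsets.subset ?_) ?_
  · rintro _ ⟨F, -, rfl⟩
    exact inter_subset_right
  · intro F hF F' hF' heq
    simp only at heq
    rw [← hF.2.isExtreme.extremePoints_eq, ← hF'.2.isExtreme.extremePoints_eq] at heq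
    rw [← closure_convexHull_extremePoints (hF.2.isCompact hΔ.isCompact)
      (hF.2.convex hΔ.convex), heq, closure_convexHull_extremePoints
      (hF'.2.isCompact hΔ.isCompact) (hF'.2.convex hΔ.convex)]

theorem eventually_mem_of_mem_intrinsicInterior {F : Set E} {p v : E}
    (hp : p ∈ intrinsicInterior ℝ F) (hv : v ∈ (affineSpan ℝ F).direction) :
    ∀ᶠ t : ℝ in 𝓝 0, p + t • v ∈ F := by
  obtain ⟨y, hy, rfl⟩ := mem_intrinsicInterior.1 hp
  have hmem : ∀ t : ℝ, (y : E) + t • v ∈ affineSpan ℝ F := fun t => by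
    rw [add_comm]
    exact AffineSubspace.vadd_mem_of_mem_direction (Submodule.smul_mem _ t hv) y.2
  have hcont : Continuous fun t : ℝ => (⟨y + t • v, hmem t⟩ : affineSpan ℝ F) := by
    fun_prop
  have h0 : (⟨y + (0 : ℝ) • v, hmem 0⟩ : affineSpan ℝ F) = y := by ext; simp
  have := hcont.continuousAt.preimage_mem_nhds (x := 0)
    (by rw [h0]; exact isOpen_interior.mem_nhds hy)
  filter_upwards [this] with t ht
  exact interior_subset (s := ((↑) ⁻¹' F : Set (affineSpan ℝ F))) ht

theorem sub_mem_direction_affineSpan {F : Set E} {p q : E} (hp : p ∈ F) (hq : q ∈ F) :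
    p - q ∈ (affineSpan ℝ F).direction := by
  rw [direction_affineSpan]
  exact vsub_mem_vectorSpan ℝ hp hq

/-- A linear functional attaining its maximum over `F` in the relative interior is constant. -/
theorem eq_of_mem_intrinsicInterior {F : Set E} {p q : E} {l : E →L[ℝ] ℝ} {c : ℝ}
    (hle : ∀ q ∈ F, l q ≤ c) (hp : p ∈ intrinsicInterior ℝ F) (hpc : l p = c) (hq : q ∈ F) :
    l q = c := by
  -- Overshoot: a small step from `p` away from `q` stays in `F`, and would push `l` above `c` if `l
  -- q < c`.
  have hev := eventually_mem_of_mem_intrinsicInterior hp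
    (sub_mem_direction_affineSpan (intrinsicInterior_subset hp) hq)
  obtain ⟨t, ht, ht0⟩ := ((hev.filter_mono nhdsWithin_le_nhds).and
    (self_mem_nhdsWithin (s := Ioi (0 : ℝ)))).exists
  have h1 := hle _ ht
  simp only [map_add, map_smul, map_sub, smul_eq_mul, hpc] at h1
  have h2 : t * (c - l q) ≤ t * 0 := by linarith
  have h3 := le_of_mul_le_mul_left h2 ht0
  linarith [hle q hq]

theorem vectorSpan_le_ker {X : Set E} {l : E →L[ℝ] ℝ} {c : ℝ} (h : ∀ q ∈ X, l q = c) :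
    vectorSpan ℝ X ≤ LinearMap.ker (l : E →ₗ[ℝ] ℝ) := by
  rw [vectorSpan_def, Submodule.span_le]
  rintro _ ⟨v, hv, u, hu, rfl⟩
  simp [h v hv, h u hu]

/-- `l G ≤ c G` on `Δ`, with equality exactly on `G`, for every facet `G`. -/
structure IsFacetFunctionals (Δ : Set E) (l : Set E → E →L[ℝ] ℝ) (c : Set E → ℝ) : Prop where
  le : ∀ G, IsFacet Δ G → ∀ q ∈ Δ, l G q ≤ c G
  mem_iff : ∀ G, IsFacet Δ G → ∀ q, q ∈ G ↔ q ∈ Δ ∧ l G q = c G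

theorem exists_isFacetFunctionals (Δ : Set E) :
    ∃ (l : Set E → E →L[ℝ] ℝ) (c : Set E → ℝ), IsFacetFunctionals Δ l c := by
  have h : ∀ G : Set E, ∃ (l : E →L[ℝ] ℝ) (c : ℝ), IsFacet Δ G →
      (∀ q ∈ Δ, l q ≤ c) ∧ ∀ q, q ∈ G ↔ q ∈ Δ ∧ l q = c := by
    intro G
    by_cases hG : IsFacet Δ G
    · obtain ⟨l, c, h⟩ := hG.1.exists_support
      exact ⟨l, c, fun _ => h⟩
    · exact ⟨0, 0, fun h => absurd h hG⟩
  choose l c h using h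
  exact ⟨l, c, fun G hG => (h G hG).1, fun G hG => (h G hG).2⟩

theorem IsPolytope.finite_facets {Δ : Set E} (hΔ : IsPolytope Δ) : {G | IsFacet Δ G}.Finite :=
  hΔ.finite_faces.subset fun _ hG => hG.1

variable {Δ : Set E} {l : Set E → E →L[ℝ] ℝ} {c : Set E → ℝ}

/-- The facets which do not contain a face stay away from its relative interior. -/
theorem IsFacetFunctionals.lt_of_not_subset (h : IsFacetFunctionals Δ l c) {F G : Set E}
    (hF : IsFace Δ F) (hG : IsFacet Δ G) (hFG : ¬F ⊆ G) {p : E}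
    (hp : p ∈ intrinsicInterior ℝ F) : l G p < c G := by
  refine lt_of_le_of_ne (h.le G hG p (hF.subset (intrinsicInterior_subset hp))) fun hpc => ?_
  refine hFG fun q hq => (h.mem_iff G hG q).2 ⟨hF.subset hq, ?_⟩
  exact eq_of_mem_intrinsicInterior (fun x hx => h.le G hG x (hF.subset hx)) hp hpc hq

/-- Finitely many strict inequalities persist on a full neighbourhood in `E`. Near `p`, only the
facets containing `F` can therefore constrain membership in `Δ`. -/
theorem IsFacetFunctionals.eventually_lt (h : IsFacetFunctionals Δ l c) (hΔ : IsPolytope Δ)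
    {F : Set E} (hF : IsFace Δ F) {p : E} (hp : p ∈ intrinsicInterior ℝ F) :
    ∀ᶠ q in 𝓝 p, ∀ G, IsFacet Δ G → ¬F ⊆ G → l G q < c G := by
  refine (Filter.eventually_all_finite hΔ.finite_facets).2 fun G hG => ?_
  by_cases hFG : F ⊆ G
  · exact Filter.Eventually.of_forall fun q hn => absurd hFG hn
  · filter_upwards [(l G).continuous.continuousAt.eventually_lt continuousAt_const
      (h.lt_of_not_subset hF hG hFG hp)] with q hq _ using hq

end FaceLattice

/-! ### Facet description of full-dimensional polytopes, and consequences of simplicity. -/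

section Facets

variable {E : Type*} [NormedAddCommGroup E] [NormedSpace ℝ E] [FiniteDimensional ℝ E]

/-- Rotating a hyperplane which separates `q` from a finite set `s` about its contact set. -/
theorem exists_larger_contact (s : Finset E) (hs : vectorSpan ℝ (s : Set E) = ⊤) {q : E}
    {l : E →L[ℝ] ℝ} {c : ℝ} (hle : ∀ v ∈ s, l v ≤ c) (hq : c < l q)
    (hT : Module.finrank ℝ (vectorSpan ℝ {v | v ∈ s ∧ l v = c}) + 1 < Module.finrank ℝ E) :
    ∃ (l' : E →L[ℝ] ℝ) (c' : ℝ), (∀ v ∈ s, l' v ≤ c') ∧ c' < l' q ∧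
      {v | v ∈ s ∧ l v = c} ⊂ {v | v ∈ s ∧ l' v = c'} := by
  classical
  set T : Set E := {v | v ∈ s ∧ l v = c} with hTdef
  -- Adjoining `q` raises the dimension by at most one, so the contact set and `q` still lie in a
  -- common hyperplane. Tilting by its functional `m` keeps the contact points in contact and
  -- preserves the gap at `q`.
  have hlt : vectorSpan ℝ (insert q (affineSpan ℝ T : Set E)) < ⊤ := by
    refine lt_top_iff_ne_top.2 fun htop => ?_
    have h1 := finrank_vectorSpan_insert_le (affineSpan ℝ T) q
    rw [htop, finrank_top, direction_affineSpan] at h1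
    omega
  obtain ⟨m₀, hm₀, hker⟩ := Submodule.exists_le_ker_of_lt_top _ hlt
  have hmT : ∀ m : E →L[ℝ] ℝ, (m : E →ₗ[ℝ] ℝ) = m₀ ∨ (m : E →ₗ[ℝ] ℝ) = -m₀ →
      ∀ v ∈ T, m v = m q := by
    intro m hm v hv
    have h1 : v - q ∈ LinearMap.ker m₀ :=
      hker (vsub_mem_vectorSpan ℝ (mem_insert_of_mem _ (subset_affineSpan ℝ T hv))
        (mem_insert _ _))
    rw [LinearMap.mem_ker] at h1
    have h2 : (m : E →ₗ[ℝ] ℝ) (v - q) = 0 := by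
      rcases hm with hm | hm <;> simp [hm, h1]
    rw [map_sub] at h2
    exact sub_eq_zero.1 h2
  obtain ⟨w, hws, hw⟩ : ∃ w ∈ s, m₀ w ≠ m₀ q := by
    by_contra! hcon
    refine hm₀ (LinearMap.ker_eq_top.1 (top_le_iff.1 ?_))
    rw [← hs, vectorSpan_def, Submodule.span_le]
    rintro _ ⟨v, hv, u, hu, rfl⟩
    simp only [SetLike.mem_coe, LinearMap.mem_ker, vsub_eq_sub, map_sub]
    rw [hcon v hv, hcon u hu, sub_self]
  obtain ⟨m, hm, hmw⟩ : ∃ m : E →L[ℝ] ℝ,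
      ((m : E →ₗ[ℝ] ℝ) = m₀ ∨ (m : E →ₗ[ℝ] ℝ) = -m₀) ∧ m q < m w := by
    rcases lt_or_gt_of_ne hw with h | h
    · exact ⟨LinearMap.toContinuousLinearMap (-m₀), Or.inr rfl, by simpa using h⟩
    · exact ⟨LinearMap.toContinuousLinearMap m₀, Or.inl rfl, by simpa using h⟩
  have hmT' := hmT m hm
  -- Ratio test: `t` is the first tilt at which a new point `u` touches the hyperplane, so no point
  -- of `s` has crossed it.
  obtain ⟨u, hu, hmin⟩ := Finset.exists_min_image (s.filter fun v => m q < m v)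
    (fun v => (c - l v) / (m v - m q)) ⟨w, by simp [hws, hmw]⟩
  rw [Finset.mem_filter] at hu
  have hupos : 0 < m u - m q := sub_pos.2 hu.2
  set t := (c - l u) / (m u - m q) with ht
  have ht0 : 0 ≤ t := div_nonneg (sub_nonneg.2 (hle u hu.1)) hupos.le
  have htu : t * (m u - m q) = c - l u := div_mul_cancel₀ _ hupos.ne'
  refine ⟨l + t • m, c + t * m q, ?_, ?_, ?_⟩
  · intro v hv
    simp only [add_apply, smul_apply, smul_eq_mul]
    by_cases hmv : m q < m v
    · have h1 := hmin v (by simp [hv, hmv])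
      rw [le_div_iff₀ (sub_pos.2 hmv)] at h1
      linarith
    · have := mul_le_mul_of_nonneg_left (not_lt.1 hmv) ht0
      linarith [hle v hv]
  · simp only [add_apply, smul_apply, smul_eq_mul]
    linarith
  · rw [ssubset_iff_exists]
    refine ⟨fun v hv => ⟨hv.1, ?_⟩, u, ⟨hu.1, ?_⟩, fun huT => hu.2.ne' (hmT' u huT)⟩
    · simp only [add_apply, smul_apply, smul_eq_mul]
      rw [hmT' v hv, hv.2]
    · simp only [add_apply, smul_apply, smul_eq_mul]
      linarith

theorem vectorSpan_eq_top_of_affDim {Δ : Set E} (hdim : affDim Δ = Module.finrank ℝ E) :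
    vectorSpan ℝ Δ = ⊤ := by
  rw [← direction_affineSpan]
  exact Submodule.eq_top_of_finrank_eq hdim

/-- A point outside a full-dimensional polytope is separated from it by a facet. -/
theorem IsPolytope.exists_facet_separating {Δ : Set E} (hΔ : IsPolytope Δ)
    (hdim : affDim Δ = Module.finrank ℝ E) {q : E} (hq : q ∉ Δ) :
    ∃ (l : E →L[ℝ] ℝ) (c : ℝ), (∀ x ∈ Δ, l x ≤ c) ∧ IsFacet Δ {x ∈ Δ | l x = c} ∧ c < l q := by
  classical
  obtain ⟨s, hs, rfl⟩ := id hΔ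
  have hle_hull : ∀ (l : E →L[ℝ] ℝ) (c : ℝ), (∀ v ∈ s, l v ≤ c) →
      ∀ x ∈ convexHull ℝ (s : Set E), l x ≤ c := fun l c h =>
    convexHull_min h (convex_halfSpace_le l.toLinearMap.isLinear c)
  have hvs : vectorSpan ℝ (s : Set E) = ⊤ := by
    rw [← vectorSpan_eq_top_of_affDim hdim, ← direction_affineSpan, ← direction_affineSpan,
      affineSpan_convexHull]
  -- Contact sets of the hyperplanes separating `q`. A maximal one must span codimension one, since
  -- otherwise `exists_larger_contact` would enlarge it.
  set P : Set (Finset E) := {T | T ⊆ s ∧ T.Nonempty ∧ ∃ (l : E →L[ℝ] ℝ) (c : ℝ),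
    (∀ v ∈ s, l v ≤ c) ∧ c < l q ∧ ∀ v, v ∈ T ↔ v ∈ s ∧ l v = c} with hP
  have hPfin : P.Finite := s.powerset.finite_toSet.subset fun T hT => by simpa using hT.1
  have hPne : P.Nonempty := by
    obtain ⟨l, u, hl, hu⟩ := geometric_hahn_banach_closed_point hΔ.convex
      hΔ.isCompact.isClosed hq
    obtain ⟨v, hv, hmax⟩ := s.exists_max_image l hs
    refine ⟨s.filter fun w => l w = l v, Finset.filter_subset _ _, ⟨v, by simp [hv]⟩, l, l v,
      hmax, ?_, fun w => by simp⟩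
    exact (hl v (subset_convexHull ℝ _ hv)).trans hu
  obtain ⟨T, ⟨hTs, hTne, l, c, hle, hlq, hTm⟩, hmax⟩ := hPfin.exists_maximal hPne
  have hTset : {v | v ∈ s ∧ l v = c} = (T : Set E) := by ext v; simp [hTm]
  obtain ⟨v₀, hv₀⟩ := hTne
  have hv₀' := (hTm v₀).1 hv₀
  have hl0 : (l : E →ₗ[ℝ] ℝ) ≠ 0 := by
    intro h0
    have hz : ∀ x, l x = 0 := fun x => LinearMap.congr_fun h0 x
    rw [hz] at hlq
    have := hv₀'.2
    rw [hz] at this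
    linarith
  refine ⟨l, c, hle_hull l c hle, ⟨IsFace.of_support (hle_hull l c hle)
    ⟨v₀, subset_convexHull ℝ _ hv₀'.1, hv₀'.2⟩, ?_⟩, hlq⟩
  have hupper : affDim {x ∈ convexHull ℝ (s : Set E) | l x = c} + 1 ≤ Module.finrank ℝ E := by
    rw [← Module.Dual.finrank_ker_add_one_of_ne_zero (K := ℝ) hl0, affDim, direction_affineSpan]
    gcongr
    exact Submodule.finrank_mono (vectorSpan_le_ker fun x hx => hx.2)
  have hlower : Module.finrank ℝ E ≤ Module.finrank ℝ (vectorSpan ℝ (T : Set E)) + 1 := by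
    by_contra! hlt
    rw [← hTset] at hlt
    obtain ⟨l', c', hle', hlq', hsub⟩ := exists_larger_contact s hvs hle hlq hlt
    rw [hTset] at hsub
    have hmem : s.filter (fun v => l' v = c') ∈ P :=
      ⟨Finset.filter_subset _ _, ⟨v₀, by simpa using hsub.1 hv₀⟩, l', c', hle', hlq', by simp⟩
    refine hsub.2 fun v hv => hmax hmem (fun w hw => ?_) (by simpa using hv)
    simpa using hsub.1 hw
  have hmono : Module.finrank ℝ (vectorSpan ℝ (T : Set E)) ≤
      affDim {x ∈ convexHull ℝ (s : Set E) | l x = c} := by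
    rw [affDim, direction_affineSpan]
    refine Submodule.finrank_mono (vectorSpan_mono ℝ fun v hv => ?_)
    exact ⟨subset_convexHull ℝ _ (hTs hv), ((hTm v).1 hv).2⟩
  rw [hdim]
  omega

variable {Δ : Set E} {l : Set E → E →L[ℝ] ℝ} {c : Set E → ℝ}

/-- A full-dimensional polytope is the intersection of the half-spaces of its facets. -/
theorem IsFacetFunctionals.mem_of_forall_le (h : IsFacetFunctionals Δ l c) (hΔ : IsPolytope Δ)
    (hdim : affDim Δ = Module.finrank ℝ E) {q : E} (hq : ∀ G, IsFacet Δ G → l G q ≤ c G) :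
    q ∈ Δ := by
  by_contra hqΔ
  obtain ⟨m, d, hle, hG, hdq⟩ := hΔ.exists_facet_separating hdim hqΔ
  set G := {x ∈ Δ | m x = d} with hGdef
  obtain ⟨g, hg⟩ := hG.1.1
  have hm0 : (m : E →ₗ[ℝ] ℝ) ≠ 0 := by
    intro h0
    have hz : ∀ x, m x = 0 := fun x => LinearMap.congr_fun h0 x
    have h1 := hg.2
    rw [hz] at h1 hdq
    linarith
  -- The facet spans the whole kernel of `m`, so `l G` and `m` are proportional up to constants. A
  -- point of `Δ` off `G` fixes the sign.
  have hker : vectorSpan ℝ G = LinearMap.ker (m : E →ₗ[ℝ] ℝ) := by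
    refine Submodule.eq_of_le_of_finrank_le (vectorSpan_le_ker fun x hx => hx.2) ?_
    have h1 := hG.2
    rw [hdim, ← Module.Dual.finrank_ker_add_one_of_ne_zero (K := ℝ) hm0, affDim,
      direction_affineSpan] at h1
    omega
  have hker' : LinearMap.ker (m : E →ₗ[ℝ] ℝ) ≤ LinearMap.ker (l G : E →ₗ[ℝ] ℝ) := by
    rw [← hker]
    exact vectorSpan_le_ker fun x hx => ((h.mem_iff G hG x).1 hx).2
  obtain ⟨p, hp, hpG⟩ : ∃ p ∈ Δ, p ∉ G := by
    by_contra! hcon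
    have h1 := hG.2
    rw [show G = Δ from Subset.antisymm hG.1.subset hcon] at h1
    omega
  have hmp : m p < d := lt_of_le_of_ne (hle p hp) fun hpd => hpG ⟨hp, hpd⟩
  have hlp : l G p < c G := lt_of_le_of_ne (h.le G hG p hp) fun hpc =>
    hpG ((h.mem_iff G hG p).2 ⟨hp, hpc⟩)
  -- A combination killed by `m`, hence by `l G`. Evaluating `l G` on it contradicts the signs
  -- without naming the proportionality factor.
  have hz : (d - m p) • (q - g) - (d - m q) • (p - g) ∈ LinearMap.ker (m : E →ₗ[ℝ] ℝ) := by
    have := hg.2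
    simp only [LinearMap.mem_ker, ContinuousLinearMap.coe_coe, map_sub, map_smul, smul_eq_mul,
      this]
    ring
  have hz' := hker' hz
  have hlg := ((h.mem_iff G hG g).1 hg).2
  simp only [LinearMap.mem_ker, ContinuousLinearMap.coe_coe, map_sub, map_smul, smul_eq_mul,
    hlg] at hz'
  have h1 : (d - m p) * (l G q - c G) ≤ 0 :=
    mul_nonpos_of_nonneg_of_nonpos (by linarith) (by linarith [hq G hG])
  have h2 : 0 < (d - m q) * (l G p - c G) := mul_pos_of_neg_of_neg (by linarith) (by linarith)
  linarith

/-- A polytope is locally a cone at a relatively interior point of a face. -/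
theorem IsFacetFunctionals.eventually_add_smul_mem (h : IsFacetFunctionals Δ l c)
    (hΔ : IsPolytope Δ) (hdim : affDim Δ = Module.finrank ℝ E) {F : Set E} (hF : IsFace Δ F)
    {p v : E} (hp : p ∈ intrinsicInterior ℝ F)
    (hv : ∀ G, IsFacet Δ G → F ⊆ G → l G v ≤ 0) :
    ∀ᶠ t : ℝ in 𝓝[>] 0, p + t • v ∈ Δ := by
  have hlim : Filter.Tendsto (fun t : ℝ => p + t • v) (𝓝[>] 0) (𝓝 p) := by
    have : Continuous fun t : ℝ => p + t • v := by fun_prop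
    simpa using (this.tendsto 0).mono_left (nhdsWithin_le_nhds (s := Ioi 0))
  filter_upwards [hlim.eventually (h.eventually_lt hΔ hF hp), self_mem_nhdsWithin] with t ht ht0
  refine h.mem_of_forall_le hΔ hdim fun G hG => ?_
  by_cases hFG : F ⊆ G
  · have h1 := h.le G hG p (hF.subset (intrinsicInterior_subset hp))
    have h2 := mul_nonpos_of_nonneg_of_nonpos (le_of_lt ht0) (hv G hG hFG)
    simp only [map_add, map_smul, smul_eq_mul]
    linarith
  · exact (ht G hG hFG).le

/-- A face is the intersection of the facets which contain it. -/
theorem IsFacetFunctionals.mem_face (h : IsFacetFunctionals Δ l c)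
    (hΔ : IsPolytope Δ) (hdim : affDim Δ = Module.finrank ℝ E) {F : Set E} (hF : IsFace Δ F)
    {q : E} (hq : q ∈ Δ) (hqF : ∀ G, IsFacet Δ G → F ⊆ G → l G q = c G) : q ∈ F := by
  obtain ⟨p, hp⟩ := hF.1.intrinsicInterior (hF.2.convex hΔ.convex)
  obtain ⟨m, d, hle, hm⟩ := hF.exists_support
  -- Overshooting past `p` away from `q` remains in `Δ`, because facets through `F` are tight at
  -- `q`. As `m` is maximal at `p`, it must be maximal at `q` too.
  have hev := h.eventually_add_smul_mem hΔ hdim hF (v := p - q) hp fun G hG hFG => by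
    rw [map_sub, hqF G hG hFG]
    linarith [h.le G hG p (hF.subset (intrinsicInterior_subset hp))]
  obtain ⟨t, ht, ht0⟩ := (hev.and self_mem_nhdsWithin).exists
  have h1 := hle _ ht
  have h2 := ((hm p).1 (intrinsicInterior_subset hp)).2
  simp only [map_add, map_smul, map_sub, smul_eq_mul, h2] at h1
  have h3 : t * (d - m q) ≤ t * 0 := by linarith
  have h4 := le_of_mul_le_mul_left h3 ht0
  exact (hm q).2 ⟨hq, le_antisymm (hle q hq) (by linarith)⟩

/-- The direction of a face is cut out by the facets which contain it. -/
theorem IsFacetFunctionals.mem_direction (h : IsFacetFunctionals Δ l c)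
    (hΔ : IsPolytope Δ) (hdim : affDim Δ = Module.finrank ℝ E) {F : Set E} (hF : IsFace Δ F)
    {v : E} (hv : ∀ G, IsFacet Δ G → F ⊆ G → l G v = 0) :
    v ∈ (affineSpan ℝ F).direction := by
  obtain ⟨p, hp⟩ := hF.1.intrinsicInterior (hF.2.convex hΔ.convex)
  have hev := h.eventually_add_smul_mem hΔ hdim hF (v := v) hp fun G hG hFG =>
    (hv G hG hFG).le
  obtain ⟨t, ht, ht0⟩ := (hev.and self_mem_nhdsWithin).exists
  have hpF := intrinsicInterior_subset hp
  have htF : p + t • v ∈ F := h.mem_face hΔ hdim hF ht fun G hG hFG => by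
    simp [hv G hG hFG, ((h.mem_iff G hG p).1 (hFG hpF)).2]
  have h1 := sub_mem_direction_affineSpan htF hpF
  rw [add_sub_cancel_left] at h1
  exact (Submodule.smul_mem_iff _ (ne_of_gt ht0)).1 h1

theorem affDim_le_finrank (X : Set E) : affDim X ≤ Module.finrank ℝ E :=
  Submodule.finrank_le _

/-- In a simple polytope a face of codimension `k` lies in exactly `k` facets, and their
functionals are linearly independent. -/
theorem IsFacetFunctionals.card_eq_and_surjective (h : IsFacetFunctionals Δ l c)
    (hΔ : IsSimplePolytope Δ) (hdim : affDim Δ = Module.finrank ℝ E) {F : Set E}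
    (hF : IsFace Δ F) {J : Finset (Set E)} (hJ : ∀ G, G ∈ J ↔ IsFacet Δ G ∧ F ⊆ G) :
    J.card = affDim Δ - affDim F ∧ Function.Surjective fun v (G : J) => l G v := by
  have hJle : J.card ≤ affDim Δ - affDim F := by
    have h1 := hΔ.2 F hF
    rw [show {G | IsFacet Δ G ∧ F ⊆ G} = (J : Set (Set E)) by ext G; simp [hJ],
      Set.encard_coe_eq_coe_finsetCard] at h1
    exact_mod_cast h1
  set A : E →ₗ[ℝ] (J → ℝ) := LinearMap.pi fun G => (l G : E →ₗ[ℝ] ℝ) with hA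
  -- The kernel has dimension at most `affDim F`, so the rank is at least the codimension;
  -- simplicity bounds the number of functionals by the codimension. Equality follows throughout.
  have hker : LinearMap.ker A ≤ (affineSpan ℝ F).direction := fun v hv =>
    h.mem_direction hΔ.1 hdim hF fun G hG hFG =>
      congr_fun (LinearMap.mem_ker.1 hv) ⟨G, (hJ G).2 ⟨hG, hFG⟩⟩
  have h1 := Submodule.finrank_mono hker
  have h2 := LinearMap.finrank_range_add_finrank_ker A
  have h3 := Submodule.finrank_le (LinearMap.range A)
  have h4 : Module.finrank ℝ (J → ℝ) = J.card := by simp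
  have h5 := affDim_le_finrank F
  rw [hdim] at hJle ⊢
  change _ ≤ affDim F at h1
  refine ⟨by omega, ?_⟩
  have htop : LinearMap.range A = ⊤ := Submodule.eq_top_of_finrank_eq (by omega)
  exact LinearMap.range_eq_top.1 htop

/-- In a simple polytope a facet containing `F ∩ F'` contains `F` or `F'`. -/
theorem IsFacetFunctionals.subset_or_subset (h : IsFacetFunctionals Δ l c)
    (hΔ : IsSimplePolytope Δ) (hdim : affDim Δ = Module.finrank ℝ E) {F F' G : Set E}
    (hF : IsFace Δ F) (hF' : IsFace Δ F') (hne : (F ∩ F').Nonempty) (hG : IsFacet Δ G)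
    (hFG : F ∩ F' ⊆ G) : F ⊆ G ∨ F' ⊆ G := by
  classical
  by_contra! hcon
  have hI := hF.inter hF' hne
  have hfin : {G | IsFacet Δ G ∧ F ∩ F' ⊆ G}.Finite :=
    hΔ.1.finite_facets.subset fun _ hG => hG.1
  obtain ⟨-, hsurj⟩ := h.card_eq_and_surjective hΔ hdim hI (J := hfin.toFinset) (by simp)
  have hGJ : G ∈ hfin.toFinset := by simp [hG, hFG]
  -- Independence provides a direction leaving `G` alone among the facets through `F ∩ F'`. If
  -- neither `F` nor `F'` lay in `G`, moving along it would stay in both faces and yet leave `G`.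
  obtain ⟨v, hv⟩ := hsurj (fun G' => if G' = ⟨G, hGJ⟩ then -1 else 0)
  have hvG : l G v = -1 := by simpa using congr_fun hv ⟨G, hGJ⟩
  have hv0 : ∀ G', IsFacet Δ G' → F ∩ F' ⊆ G' → G' ≠ G → l G' v = 0 := fun G' hG' hs hne =>
    (congr_fun hv ⟨G', by simp [hG', hs]⟩).trans
      (if_neg fun heq => hne (congrArg Subtype.val heq))
  obtain ⟨p, hp⟩ := hI.1.intrinsicInterior (hI.2.convex hΔ.1.convex)
  have hev := h.eventually_add_smul_mem hΔ.1 hdim hI (v := v) hp fun G' hG' hs => by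
    by_cases hGG : G' = G
    · rw [hGG, hvG]; norm_num
    · exact (hv0 G' hG' hs hGG).le
  obtain ⟨t, ht, ht0⟩ := (hev.and self_mem_nhdsWithin).exists
  have hpI := intrinsicInterior_subset hp
  have key : ∀ G', IsFacet Δ G' → F ∩ F' ⊆ G' → G' ≠ G → l G' (p + t • v) = c G' :=
    fun G' hG' hs hne => by
      simp [hv0 G' hG' hs hne, ((h.mem_iff G' hG' p).1 (hs hpI)).2]
  have hmem : p + t • v ∈ F ∩ F' := by
    refine ⟨h.mem_face hΔ.1 hdim hF ht fun G' hG' hs => key G' hG' (inter_subset_left.trans hs) ?_,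
      h.mem_face hΔ.1 hdim hF' ht fun G' hG' hs => key G' hG' (inter_subset_right.trans hs) ?_⟩
    · rintro rfl; exact hcon.1 hs
    · rintro rfl; exact hcon.2 hs
  have h1 := ((h.mem_iff G hG _).1 (hFG hmem)).2
  have h2 := ((h.mem_iff G hG p).1 (hFG hpI)).2
  simp only [map_add, map_smul, smul_eq_mul, hvG, h2] at h1
  have : t = 0 := by linarith
  exact (ne_of_gt ht0) this

end Facets

/-! ### Gluing the face models and deducing the critical-point property. -/

section Gluing

variable {E : Type*} [NormedAddCommGroup E] [NormedSpace ℝ E]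

/-- Gluing the functions `α F + δ Q F - κ Y F`, for `δ` small and `κ` large, into a function which
increases along the rays from `x F` in each `F`. -/
theorem exists_radially_increasing (𝓕 : Finset (Set E)) (h𝓕 : 𝓕.Nonempty)
    (x : Set E → E) (α : Set E → ℝ) (Q Y : Set E → E → ℝ)
    (hcomp : ∀ F ∈ 𝓕, IsCompact F) (hx : ∀ F ∈ 𝓕, x F ∈ F)
    (hinter : ∀ F ∈ 𝓕, ∀ F' ∈ 𝓕, (F ∩ F').Nonempty → F ∩ F' ∈ 𝓕)
    (hxn : ∀ F ∈ 𝓕, ∀ F' ∈ 𝓕, F ⊂ F' → x F' ∉ F)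
    (hα : ∀ F ∈ 𝓕, ∀ F' ∈ 𝓕, F' ⊂ F → α F < α F')
    (hQ : ∀ F ∈ 𝓕, ContDiff ℝ ∞ (Q F)) (hY : ∀ F ∈ 𝓕, ContDiff ℝ ∞ (Y F))
    (hQ0 : ∀ F ∈ 𝓕, Q F (x F) = 0) (hQnn : ∀ F ∈ 𝓕, ∀ q, 0 ≤ Q F q)
    (hQd : ∀ F ∈ 𝓕, ∀ q ∈ F, q ≠ x F → 0 < fderiv ℝ (Q F) q (q - x F))
    (hY0 : ∀ F ∈ 𝓕, ∀ q ∈ F, Y F q = 0)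
    (hYpos : ∀ F ∈ 𝓕, ∀ F' ∈ 𝓕, ∀ q ∈ F', q ∉ F → 0 < Y F q)
    (hYinter : ∀ F ∈ 𝓕, ∀ F' ∈ 𝓕, (F ∩ F').Nonempty → ∀ q ∈ F', Y (F ∩ F') q = Y F q)
    (hYd : ∀ F ∈ 𝓕, ∀ q p, fderiv ℝ (Y F) q (q - p) = Y F q - Y F p) :
    ∃ δ > 0, ∃ κ > 0, ∃ f : E → ℝ, ContDiff ℝ ∞ f ∧ ∀ F ∈ 𝓕,
      (∀ q ∈ F, q ≠ x F → 0 < fderiv ℝ f q (q - x F)) ∧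
      f =ᶠ[𝓝 (x F)] fun q => α F + δ * Q F q - κ * Y F q := by
  classical
  obtain ⟨D, hD0, hD⟩ : ∃ D : ℝ, 0 ≤ D ∧ ∀ F ∈ 𝓕, ∀ F' ∈ 𝓕, ∀ q ∈ F',
      Q F q ≤ D ∧ -D ≤ fderiv ℝ (Q F) q (q - x F') := by
    have hev : ∀ᶠ D in Filter.atTop, ∀ F ∈ 𝓕, ∀ F' ∈ 𝓕, ∀ q ∈ F',
        Q F q ≤ D ∧ -D ≤ fderiv ℝ (Q F) q (q - x F') := by
      refine 𝓕.eventually_all.2 fun F hF => 𝓕.eventually_all.2 fun F' hF' => ?_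
      obtain ⟨B, hB⟩ := (hcomp F' hF').bddAbove_image (hQ F hF).continuous.continuousOn
      have hc : Continuous fun q => fderiv ℝ (Q F) q (q - x F') :=
        ((hQ F hF).continuous_fderiv (by simp)).clm_apply (continuous_id.sub continuous_const)
      obtain ⟨B', hB'⟩ := (hcomp F' hF').bddBelow_image hc.continuousOn
      filter_upwards [Filter.eventually_ge_atTop B, Filter.eventually_ge_atTop (-B')]
        with D h1 h2 q hq
      exact ⟨(hB (mem_image_of_mem _ hq)).trans h1,
        by linarith [hB' (mem_image_of_mem _ hq)]⟩
    obtain ⟨D, h1, h2⟩ := (hev.and (Filter.eventually_ge_atTop 0)).exists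
    exact ⟨D, h2, h1⟩
  -- Here `δ * D` absorbs the variation of `δ Q F`, and the extra `δ` is the tolerance of the
  -- regularized maximum taken later.
  obtain ⟨δ, hδ0, hδ⟩ : ∃ δ : ℝ, 0 < δ ∧ ∀ F ∈ 𝓕, ∀ F' ∈ 𝓕, F' ⊂ F →
      α F + δ * (D + 1) < α F' := by
    have hev : ∀ᶠ δ : ℝ in 𝓝[>] 0, ∀ F ∈ 𝓕, ∀ F' ∈ 𝓕, F' ⊂ F → α F + δ * (D + 1) < α F' := by
      refine 𝓕.eventually_all.2 fun F hF => 𝓕.eventually_all.2 fun F' hF' => ?_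
      by_cases hs : F' ⊂ F
      · have hc : Continuous fun δ : ℝ => α F + δ * (D + 1) := by fun_prop
        have := hc.continuousAt.eventually_lt continuousAt_const
          (x₀ := 0) (g := fun _ => α F') (by simpa using hα F hF F' hF' hs)
        filter_upwards [this.filter_mono nhdsWithin_le_nhds] with δ h _ using h
      · exact Filter.Eventually.of_forall fun _ h => absurd h hs
    obtain ⟨δ, h1, h2⟩ := (hev.and self_mem_nhdsWithin).exists
    exact ⟨δ, h2, h1⟩
  -- The first condition suppresses faces disjoint from `F'`. The second serves the ray derivative:
  -- if `F ⊂ F'` is active at `q`, then `κ * Y F q ≤ α F - α F' + δ * (D + 1)`, while the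
  -- differential of `δ Q F` can cost another `δ * D`; hence `2 * D + 1`.
  obtain ⟨κ, hκ0, hκ⟩ : ∃ κ : ℝ, 0 < κ ∧ ∀ F ∈ 𝓕, ∀ F' ∈ 𝓕,
      (¬(F ∩ F').Nonempty → ∀ q ∈ F', α F + δ * (D + 1) - κ * Y F q < α F') ∧
      (F ⊂ F' → α F + δ * (2 * D + 1) - κ * Y F (x F') < α F') := by
    have hlin : ∀ a b m : ℝ, 0 < m → ∀ᶠ κ in Filter.atTop, a - κ * m < b := by
      intro a b m hm
      filter_upwards [Filter.eventually_gt_atTop ((a - b) / m)] with κ hκ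
      rw [div_lt_iff₀ hm] at hκ
      linarith
    have hev : ∀ᶠ κ : ℝ in Filter.atTop, ∀ F ∈ 𝓕, ∀ F' ∈ 𝓕,
        (¬(F ∩ F').Nonempty → ∀ q ∈ F', α F + δ * (D + 1) - κ * Y F q < α F') ∧
        (F ⊂ F' → α F + δ * (2 * D + 1) - κ * Y F (x F') < α F') := by
      refine 𝓕.eventually_all.2 fun F hF => 𝓕.eventually_all.2 fun F' hF' => ?_
      refine Filter.Eventually.and ?_ ?_
      · by_cases hne : (F ∩ F').Nonempty
        · exact Filter.Eventually.of_forall fun _ h => absurd hne h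
        · obtain ⟨q₀, hq₀, hmin⟩ := (hcomp F' hF').exists_isMinOn ⟨_, hx F' hF'⟩
            (hY F hF).continuous.continuousOn
          have hpos := hYpos F hF F' hF' q₀ hq₀ fun h => hne ⟨q₀, h, hq₀⟩
          filter_upwards [hlin (α F + δ * (D + 1)) (α F') _ hpos,
            Filter.eventually_ge_atTop 0] with κ h hκ0 _ q hq
          have := mul_le_mul_of_nonneg_left (hmin hq) hκ0
          linarith
      · by_cases hs : F ⊂ F'
        · have hpos := hYpos F hF F' hF' _ (hx F' hF') (hxn F hF F' hF' hs)
          filter_upwards [hlin (α F + δ * (2 * D + 1)) (α F') _ hpos] with κ h _ using h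
        · exact Filter.Eventually.of_forall fun _ h => absurd h hs
    obtain ⟨κ, h1, h2⟩ := (hev.and (Filter.eventually_gt_atTop 0)).exists
    exact ⟨κ, h2, h1⟩
  set h : Set E → E → ℝ := fun F q => α F + δ * Q F q - κ * Y F q with hh
  have hsm : ∀ F ∈ 𝓕, ContDiff ℝ ∞ (h F) := fun F hF =>
    (contDiff_const.add (contDiff_const.mul (hQ F hF))).sub (contDiff_const.mul (hY F hF))
  have hfd : ∀ F ∈ 𝓕, ∀ q v, fderiv ℝ (h F) q v =
      δ * fderiv ℝ (Q F) q v - κ * fderiv ℝ (Y F) q v := by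
    intro F hF q v
    have h1 := ((hQ F hF).differentiable (by simp) q).hasFDerivAt
    have h2 := ((hY F hF).differentiable (by simp) q).hasFDerivAt
    have h3 : HasFDerivAt (h F) (δ • fderiv ℝ (Q F) q - κ • fderiv ℝ (Y F) q) q :=
      ((h1.const_mul δ).const_add (α F)).sub (h2.const_mul κ)
    rw [h3.fderiv]
    simp
  have hlow : ∀ F ∈ 𝓕, ∀ q ∈ F, α F ≤ h F q := by
    intro F hF q hq
    simp only [hh, hY0 F hF q hq]
    linarith [mul_nonneg hδ0.le (hQnn F hF q)]
  have hupp : ∀ F ∈ 𝓕, ∀ F' ∈ 𝓕, ∀ q ∈ F', h F q ≤ α F + δ * D - κ * Y F q := by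
    intro F hF F' hF' q hq
    simp only [hh]
    linarith [mul_le_mul_of_nonneg_left (hD F hF F' hF' q hq).1 hδ0.le]
  have hnot : ∀ F ∈ 𝓕, ∀ F' ∈ 𝓕, ∀ q ∈ F', ¬(F ∩ F').Nonempty → h F q + δ < h F' q := by
    intro F hF F' hF' q hq hne
    linarith [(hκ F hF F' hF').1 hne q hq, hlow F' hF' q hq, hupp F hF F' hF' q hq]
  have hmeet : ∀ F ∈ 𝓕, ∀ F' ∈ 𝓕, ∀ q ∈ F', ¬F ⊆ F' → (F ∩ F').Nonempty →
      h F q + δ < h (F ∩ F') q := by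
    intro F hF F' hF' q hq hs hne
    have hI := hinter F hF F' hF' hne
    have h1 := hδ F hF _ hI
      ⟨inter_subset_left, fun hsub => hs (hsub.trans inter_subset_right)⟩
    have h2 := mul_nonneg hδ0.le (hQnn _ hI q)
    have h3 := hupp F hF F' hF' q hq
    have h4 : h (F ∩ F') q = α (F ∩ F') + δ * Q (F ∩ F') q - κ * Y F q := by
      simp only [hh, hYinter F hF F' hF' hne q hq]
    linarith
  obtain ⟨f, hf, hle, -, hw, heq⟩ := exists_regularized_max 𝓕 h𝓕 h hsm hδ0
  refine ⟨δ, hδ0, κ, hκ0, f, hf, fun F' hF' => ⟨?_, ?_⟩⟩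
  · intro q hq hqx
    obtain ⟨w, hw0, hw1, hwd, hwa⟩ := hw q
    have hpos : ∀ F ∈ 𝓕, w F ≠ 0 → 0 < fderiv ℝ (h F) q (q - x F') := by
      intro F hF hwF
      have hact := hwa F hF hwF
      have hs : F ⊆ F' := by
        by_contra hs
        by_cases hne : (F ∩ F').Nonempty
        · linarith [hmeet F hF F' hF' q hq hs hne, hle q _ (hinter F hF F' hF' hne)]
        · linarith [hnot F hF F' hF' q hq hne, hle q F' hF']
      rw [hfd F hF, hYd F hF]
      rcases hs.eq_or_ssubset with rfl | hss
      · rw [hY0 F hF q hq, hY0 F hF _ (hx F hF)]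
        simpa using mul_pos hδ0 (hQd F hF q hq hqx)
      · have h1 := (hκ F hF F' hF').2 hss
        have h2 := hle q F' hF'
        have h3 := hlow F' hF' q hq
        have h4 := hupp F hF F' hF' q hq
        have h5 := mul_le_mul_of_nonneg_left (hD F hF F' hF' q hq).2 hδ0.le
        linarith
    rw [hwd, sum_apply]
    simp only [smul_apply, smul_eq_mul]
    have hnn : ∀ F ∈ 𝓕, 0 ≤ w F * fderiv ℝ (h F) q (q - x F') := by
      intro F hF
      by_cases hwF : w F = 0
      · simp [hwF]
      · exact mul_nonneg (hw0 F hF) (hpos F hF hwF).le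
    obtain ⟨F, hF, hwF⟩ : ∃ F ∈ 𝓕, w F ≠ 0 := by
      by_contra! hcon
      rw [Finset.sum_eq_zero hcon] at hw1
      exact zero_ne_one hw1
    exact Finset.sum_pos' hnn ⟨F, hF, mul_pos (lt_of_le_of_ne (hw0 F hF) hwF.symm)
      (hpos F hF hwF)⟩
  · have hxF := hx F' hF'
    have hval : h F' (x F') = α F' := by simp [hh, hQ0 F' hF', hY0 F' hF' _ hxF]
    have hsub : ∀ F ∈ 𝓕, F ⊂ F' → h F (x F') + δ < h F' (x F') := by
      intro F hF hss
      have h1 := (hκ F hF F' hF').2 hss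
      have h2 := hupp F hF F' hF' _ hxF
      have h3 := mul_nonneg hδ0.le hD0
      linarith
    have hlt : ∀ F ∈ 𝓕, F ≠ F' → h F (x F') + δ < h F' (x F') := by
      intro F hF hne
      by_cases hs : F ⊆ F'
      · exact hsub F hF (hs.ssubset_of_ne hne)
      by_cases hI : (F ∩ F').Nonempty
      -- Compare through `F ∩ F'`, which either equals `F'` or is a proper subface already handled.
      · have h1 := hmeet F hF F' hF' _ hxF hs hI
        rcases (inter_subset_right (s := F) (t := F')).eq_or_ssubset with h2 | h2
        · rwa [h2] at h1
        · linarith [hsub _ (hinter F hF F' hF' hI) h2]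
      · exact hnot F hF F' hF' _ hxF hI
    have hev : ∀ᶠ q in 𝓝 (x F'), ∀ F ∈ 𝓕, F ≠ F' → h F q + δ < h F' q := by
      refine 𝓕.eventually_all.2 fun F hF => ?_
      by_cases hne : F = F'
      · exact Filter.Eventually.of_forall fun _ h => absurd hne h
      · filter_upwards [((hsm F hF).continuous.add continuous_const).continuousAt.eventually_lt
          (hsm F' hF').continuous.continuousAt (hlt F hF hne)] with q hq _ using hq
    filter_upwards [hev] with q hq using heq q F' hF' hq

/-- A smooth function increasing along the rays from `p` in `F` has its only critical point in the
relative interior of `F`, and its minimum, at `p`. -/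
theorem hasUniqueCriticalMinAt_of_radial {F : Set E} (hF : Convex ℝ F) {f : E → ℝ}
    (hf : Differentiable ℝ f) {p : E} (hp : p ∈ intrinsicInterior ℝ F)
    (hrad : ∀ q ∈ F, q ≠ p → 0 < fderiv ℝ f q (q - p)) : HasUniqueCriticalMinAt f F p := by
  have hpF := intrinsicInterior_subset hp
  have hder : ∀ q : E, HasFDerivAt (fun v : (affineSpan ℝ F).direction => f ((v : E) + q))
      ((fderiv ℝ f q).comp (affineSpan ℝ F).direction.subtypeL) 0 := by
    intro q
    have h1 : HasFDerivAt (fun v : (affineSpan ℝ F).direction => (v : E) + q)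
        (affineSpan ℝ F).direction.subtypeL 0 :=
      ((affineSpan ℝ F).direction.subtypeL.hasFDerivAt).add_const q
    have h2 : HasFDerivAt f (fderiv ℝ f q)
        (((0 : (affineSpan ℝ F).direction) : E) + q) := by
      simpa using (hf q).hasFDerivAt
    exact h2.comp (0 : (affineSpan ℝ F).direction) h1
  have hmin : ∀ q ∈ F, q ≠ p → f p < f q := by
    intro q hq hqp
    have hline : ∀ t : ℝ, HasDerivAt (fun t : ℝ => f (p + t • (q - p)))
        (fderiv ℝ f (p + t • (q - p)) (q - p)) t := by
      intro t
      have h1 : HasDerivAt (fun t : ℝ => p + t • (q - p)) (q - p) t := by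
        simpa using ((hasDerivAt_id t).smul_const (q - p)).const_add p
      exact (hf _).hasFDerivAt.comp_hasDerivAt t h1
    have hmono : StrictMonoOn (fun t : ℝ => f (p + t • (q - p))) (Icc 0 1) := by
      refine strictMonoOn_of_deriv_pos (convex_Icc 0 1)
        (fun t _ => (hline t).continuousAt.continuousWithinAt) fun t ht => ?_
      rw [interior_Icc] at ht
      rw [(hline t).deriv]
      have hmem : p + t • (q - p) ∈ F := hF.add_smul_sub_mem hpF hq ⟨ht.1.le, ht.2.le⟩
      have hne : p + t • (q - p) ≠ p := by
        simpa using ⟨ht.1.ne', sub_ne_zero.2 hqp⟩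
      have := hrad _ hmem hne
      rw [add_sub_cancel_left, map_smul, smul_eq_mul] at this
      exact pos_of_mul_pos_right this ht.1.le
    simpa using hmono (left_mem_Icc.2 zero_le_one) (right_mem_Icc.2 zero_le_one) zero_lt_one
  refine ⟨hp, hmin, ?_, ?_⟩
  · have hloc : IsLocalMin (fun v : (affineSpan ℝ F).direction => f ((v : E) + p)) 0 := by
      obtain ⟨y, hy, hyp⟩ := mem_intrinsicInterior.1 hp
      have hmem : ∀ v : (affineSpan ℝ F).direction, (v : E) + p ∈ affineSpan ℝ F := fun v =>
        AffineSubspace.vadd_mem_of_mem_direction v.2 (subset_affineSpan ℝ F hpF)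
      have hcont : Continuous fun v : (affineSpan ℝ F).direction =>
          (⟨(v : E) + p, hmem v⟩ : affineSpan ℝ F) := by fun_prop
      have h0 : (⟨((0 : (affineSpan ℝ F).direction) : E) + p, hmem 0⟩ : affineSpan ℝ F) = y := by
        ext; simp [hyp]
      filter_upwards [hcont.continuousAt.preimage_mem_nhds (x := 0)
        (by rw [h0]; exact isOpen_interior.mem_nhds hy)] with v hv
      have hvF : (v : E) + p ∈ F :=
        interior_subset (s := ((↑) ⁻¹' F : Set (affineSpan ℝ F))) hv
      by_cases hvp : (v : E) + p = p
      · simp [hvp]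
      · simpa using (hmin _ hvF hvp).le
    have h1 := hder p
    rwa [hloc.hasFDerivAt_eq_zero h1] at h1
  · intro q hq hcrit
    by_contra hqp
    have hqF := intrinsicInterior_subset hq
    have h1 := (hder q).unique hcrit
    -- At another critical point the differential would vanish on the tangent direction `q - p`,
    -- contrary to radial increase.
    have h2 := congrArg
      (fun L => L ⟨q - p, sub_mem_direction_affineSpan hqF hpF⟩) h1
    simp only [ContinuousLinearMap.comp_apply, Submodule.subtypeL_apply,
      zero_apply] at h2
    exact (hrad q hqF hqp).ne' h2

end Gluing

/-! ### Radial derivatives of the model terms. -/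

section Derivatives

variable {E : Type*} [NormedAddCommGroup E] [NormedSpace ℝ E]

theorem contDiff_sum_sq {k : ℕ} (ξ : E →L[ℝ] (Fin k → ℝ)) (p : E) :
    ContDiff ℝ ∞ fun q => ∑ j, ξ (q - p) j ^ 2 := by
  have : ∀ j, ContDiff ℝ ∞ fun q => ξ (q - p) j := fun j =>
    contDiff_pi.1 (ξ.contDiff.comp (contDiff_id.sub contDiff_const)) j
  exact ContDiff.sum fun j _ => (this j).pow 2

/-- Euler's identity for a function homogeneous of degree two about `p`; it makes `Q F` increase
along rays from `x F`. -/
theorem fderiv_sum_sq {k : ℕ} (ξ : E →L[ℝ] (Fin k → ℝ)) (p q : E) :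
    fderiv ℝ (fun q => ∑ j, ξ (q - p) j ^ 2) q (q - p) = 2 * ∑ j, ξ (q - p) j ^ 2 := by
  have hj : ∀ j, HasFDerivAt (fun q => ξ (q - p) j ^ 2)
      ((2 * ξ (q - p) j) • (ContinuousLinearMap.proj j).comp ξ) q := by
    intro j
    have h1 : HasFDerivAt (fun q => ξ (q - p) j)
        ((ContinuousLinearMap.proj (R := ℝ) (φ := fun _ : Fin k => ℝ) j).comp ξ) q :=
      ((ContinuousLinearMap.proj (R := ℝ) (φ := fun _ : Fin k => ℝ) j).comp ξ).hasFDerivAt.comp q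
        ((hasFDerivAt_id q).sub_const p)
    simpa using h1.pow 2
  rw [(HasFDerivAt.fun_sum fun j _ => hj j).fderiv, sum_apply, Finset.mul_sum]
  refine Finset.sum_congr rfl fun j _ => ?_
  simp
  ring

theorem fderiv_sum_affine (l : Set E → E →L[ℝ] ℝ) (c : Set E → ℝ) (J : Finset (Set E)) (q p : E) :
    fderiv ℝ (fun q => ∑ G ∈ J, (c G - l G q)) q (q - p) =
      ∑ G ∈ J, (c G - l G q) - ∑ G ∈ J, (c G - l G p) := by
  have hj : ∀ G ∈ J, HasFDerivAt (fun q => c G - l G q) (-l G) q := fun G _ =>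
    (l G).hasFDerivAt.const_sub (c G)
  rw [(HasFDerivAt.fun_sum hj).fderiv, sum_apply, ← Finset.sum_sub_distrib]
  refine Finset.sum_congr rfl fun G _ => ?_
  simp

theorem ContDiff.isSmoothOnSet {f : E → ℝ} (hf : ContDiff ℝ ∞ f) (X : Set E) :
    IsSmoothOnSet f X := fun x _ =>
  ⟨univ, isOpen_univ, mem_univ x, f, hf.contDiffOn, fun _ _ => rfl⟩

end Derivatives

/-! ### Normal form and assembly. -/

section Assembly

variable {E : Type*} [NormedAddCommGroup E] [NormedSpace ℝ E] [FiniteDimensional ℝ E]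
  {Δ : Set E} {l : Set E → E →L[ℝ] ℝ} {c : Set E → ℝ}

theorem exists_injOn_coordinates (W : Submodule ℝ E) :
    ∃ ξ : E →L[ℝ] (Fin (Module.finrank ℝ W) → ℝ), ∀ v ∈ W, ξ v = 0 → v = 0 := by
  obtain ⟨g, hg⟩ := LinearMap.exists_extend
    ((Module.finBasis ℝ W).equivFun : W →ₗ[ℝ] (Fin (Module.finrank ℝ W) → ℝ))
  refine ⟨LinearMap.toContinuousLinearMap g, fun v hv h0 => ?_⟩
  have h1 : (Module.finBasis ℝ W).equivFun ⟨v, hv⟩ = 0 := by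
    rw [← LinearEquiv.coe_coe, ← hg]
    exact h0
  exact congrArg Subtype.val ((LinearEquiv.map_eq_zero_iff _).1 h1)

/-- The normal form, with coordinates `√δ ξ` along the face and `κ (c G - l G)` transversally. -/
theorem IsFacetFunctionals.hasNormalFormAt (h : IsFacetFunctionals Δ l c)
    (hΔ : IsSimplePolytope Δ) (hdim : affDim Δ = Module.finrank ℝ E) {F : Set E}
    (hF : IsFace Δ F) {J : Finset (Set E)} (hJ : ∀ G, G ∈ J ↔ IsFacet Δ G ∧ F ⊆ G)
    {p : E} (hp : p ∈ intrinsicInterior ℝ F) (ξ : E →L[ℝ] (Fin (affDim F) → ℝ))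
    (hξ : ∀ v ∈ (affineSpan ℝ F).direction, ξ v = 0 → v = 0) {α δ κ : ℝ} (hδ : 0 < δ)
    (hκ : 0 < κ) {f : E → ℝ}
    (hf : f =ᶠ[𝓝 p] fun q => α + δ * ∑ j, ξ (q - p) j ^ 2 - κ * ∑ G ∈ J, (c G - l G q)) :
    HasNormalFormAt Δ f F p := by
  have hpF := intrinsicInterior_subset hp
  obtain ⟨hcard, -⟩ := h.card_eq_and_surjective hΔ hdim hF hJ
  set σ : Fin (affDim Δ - affDim F) ≃ J := (J.equivFinOfCardEq hcard).symm with hσ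
  have hσJ : ∀ j, IsFacet Δ (σ j) ∧ F ⊆ σ j := fun j => (hJ _).1 (σ j).2
  have hJσ : ∀ G, IsFacet Δ G → F ⊆ G → ∃ j, (σ j : Set E) = G := fun G hG hFG =>
    ⟨σ.symm ⟨G, (hJ G).2 ⟨hG, hFG⟩⟩, by simp⟩
  have hlp : ∀ G, IsFacet Δ G → F ⊆ G → l G p = c G := fun G hG hFG =>
    ((h.mem_iff G hG p).1 (hFG hpF)).2
  set A : E →ₗ[ℝ] (Fin (affDim F) → ℝ) × (Fin (affDim Δ - affDim F) → ℝ) :=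
    (√δ • (ξ : E →ₗ[ℝ] (Fin (affDim F) → ℝ))).prod
      (LinearMap.pi fun j => (-κ) • (l (σ j) : E →ₗ[ℝ] ℝ)) with hA
  have hA1 : ∀ v j, (A v).1 j = √δ * ξ v j := fun v j => by simp [hA]
  have hA2 : ∀ v j, (A v).2 j = -κ * l (σ j) v := fun v j => by simp [hA]
  have hsδ : 0 < √δ := Real.sqrt_pos.2 hδ
  -- Vanishing of the transversal part puts `v` in the direction of `F`, where `ξ` is injective.
  -- Equality of dimensions then makes `A` an isomorphism.
  have hinj : Function.Injective A := by
    refine (injective_iff_map_eq_zero A).2 fun v hv => ?_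
    refine hξ v (h.mem_direction hΔ.1 hdim hF fun G hG hFG => ?_) (funext fun j => ?_)
    · obtain ⟨j, rfl⟩ := hJσ G hG hFG
      have := hA2 v j
      rw [hv] at this
      simpa [hκ.ne'] using this
    · have := hA1 v j
      rw [hv] at this
      simpa [hsδ.ne'] using this
  have hFle := affDim_le_finrank F
  have hrank : Module.finrank ℝ E = Module.finrank ℝ
      ((Fin (affDim F) → ℝ) × (Fin (affDim Δ - affDim F) → ℝ)) := by
    simp only [Module.finrank_prod, Module.finrank_fin_fun]
    omega
  set e : E ≃ᵃ[ℝ] (Fin (affDim F) → ℝ) × (Fin (affDim Δ - affDim F) → ℝ) :=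
    (AffineEquiv.vaddConst ℝ p).symm.trans (A.linearEquivOfInjective hinj hrank).toAffineEquiv
    with he
  have heq : ∀ q, e q = A (q - p) := fun q => by simp [he]
  have he1 : ∀ q j, (e q).1 j = √δ * ξ (q - p) j := fun q j => by rw [heq, hA1]
  have he2 : ∀ q j, (e q).2 j = κ * (c (σ j) - l (σ j) q) := fun q j => by
    rw [heq, hA2, map_sub, hlp _ (hσJ j).1 (hσJ j).2]
    ring
  have hep : e p = 0 := by rw [heq, sub_self, map_zero]
  have hcont : Continuous e := by
    rw [show (e : E → _) = fun q => A (q - p) from funext heq]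
    exact (LinearMap.continuous_of_finiteDimensional A).comp (continuous_id.sub continuous_const)
  have hcont' : Continuous e.symm := AffineMap.continuous_of_finiteDimensional e.symm.toAffineMap
  have hev := hf.and (h.eventually_lt hΔ.1 hF hp)
  have hsymm : e.symm 0 = p := by rw [← hep, e.symm_apply_apply]
  have hlim : Filter.Tendsto e.symm (𝓝 0) (𝓝 p) := hsymm ▸ hcont'.tendsto 0
  obtain ⟨ε, hε, hball⟩ := Metric.eventually_nhds_iff_ball.1 (hlim.eventually hev)
  -- The sup norm makes balls into cubes, so a single radius gives the required box.
  have hbox : ∀ z : (Fin (affDim F) → ℝ) × (Fin (affDim Δ - affDim F) → ℝ),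
      z ∈ Metric.ball 0 ε ↔ (∀ j, z.1 j ∈ Ioo (-ε) ε) ∧ ∀ j, z.2 j ∈ Ioo (-ε) ε := by
    intro z
    rw [mem_ball_zero_iff, Prod.norm_def, max_lt_iff, pi_norm_lt_iff hε, pi_norm_lt_iff hε]
    simp only [Real.norm_eq_abs, abs_lt, mem_Ioo]
  -- Defined by coordinates alone. It lies in `Δ` because `y ≥ 0` gives the facets through `F` and
  -- smallness of `ε` gives the others.
  set U : Set E := {q | (∀ j, (e q).1 j ∈ Ioo (-ε) ε) ∧ ∀ j, (e q).2 j ∈ Ico 0 ε} with hU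
  have hUball : ∀ q ∈ U, e q ∈ Metric.ball 0 ε := fun q hq =>
    (hbox _).2 ⟨hq.1, fun j => ⟨by linarith [(hq.2 j).1], (hq.2 j).2⟩⟩
  have hUev : ∀ q ∈ U, (f q = α + δ * ∑ j, ξ (q - p) j ^ 2 - κ * ∑ G ∈ J, (c G - l G q)) ∧
      ∀ G, IsFacet Δ G → ¬F ⊆ G → l G q < c G := fun q hq => by
    have := hball _ (hUball q hq)
    rwa [e.symm_apply_apply] at this
  have hUΔ : U ⊆ Δ := fun q hq => h.mem_of_forall_le hΔ.1 hdim fun G hG => by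
    by_cases hFG : F ⊆ G
    · obtain ⟨j, rfl⟩ := hJσ G hG hFG
      have h1 := (hq.2 j).1
      rw [he2] at h1
      linarith [nonneg_of_mul_nonneg_right h1 hκ]
    · exact ((hUev q hq).2 G hG hFG).le
  -- The factors `δ` and `κ` are absorbed into the coordinates, so `a = 1` and `b = α`.
  refine ⟨ε, hε, e, U, hUΔ, ?_, hep, ?_, ?_, 1, α, one_pos, ?_⟩
  · have h1 : ∀ᶠ q in 𝓝 p, e q ∈ Metric.ball 0 ε :=
      hcont.continuousAt.eventually (by rw [hep]; exact Metric.ball_mem_nhds 0 hε)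
    filter_upwards [h1.filter_mono nhdsWithin_le_nhds, self_mem_nhdsWithin] with q hq hqΔ
    have h2 := (hbox _).1 hq
    refine ⟨h2.1, fun j => ⟨?_, (h2.2 j).2⟩⟩
    rw [he2]
    exact mul_nonneg hκ.le (sub_nonneg.2 (h.le _ (hσJ j).1 q hqΔ))
  · ext z
    constructor
    · rintro ⟨q, hq, rfl⟩
      exact hq
    · intro hz
      refine ⟨e.symm z, ?_, e.apply_symm_apply z⟩
      simpa only [hU, mem_ofPred_eq, e.apply_symm_apply] using hz
  · ext q
    refine and_congr_right fun hq => ⟨fun hqF => funext fun j => ?_, fun hq0 => ?_⟩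
    · rw [he2, ((h.mem_iff _ (hσJ j).1 q).1 ((hσJ j).2 hqF)).2]
      simp
    · refine h.mem_face hΔ.1 hdim hF (hUΔ hq) fun G hG hFG => ?_
      obtain ⟨j, rfl⟩ := hJσ G hG hFG
      have h1 := congr_fun hq0 j
      rw [he2] at h1
      have h2 := (mul_eq_zero.1 h1).resolve_left hκ.ne'
      linarith
  · intro q hq
    rw [(hUev q hq).1]
    have h1 : ∑ j, (e q).1 j ^ 2 = δ * ∑ j, ξ (q - p) j ^ 2 := by
      rw [Finset.mul_sum]
      refine Finset.sum_congr rfl fun j _ => ?_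
      rw [he1, mul_pow, Real.sq_sqrt hδ.le]
    have h2 : ∑ j, (e q).2 j = κ * ∑ G ∈ J, (c G - l G q) := by
      rw [Finset.mul_sum, ← Finset.sum_coe_sort J, ← Equiv.sum_comp σ]
      exact Finset.sum_congr rfl fun j _ => he2 q j
    rw [h1, h2]
    ring

/-- No sign condition on `α` is needed: the gluing uses only its strict monotonicity. Both halves of
the main theorem follow from this. -/
theorem exists_function_on_simplePolytope (hΔ : IsSimplePolytope Δ)
    (hdim : affDim Δ = Module.finrank ℝ E) (x : Set E → E) (α : Set E → ℝ)
    (hx : ∀ F, IsFace Δ F → x F ∈ intrinsicInterior ℝ F)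
    (hα : ∀ F F', IsFace Δ F → IsFace Δ F' → F' ⊂ F → α F < α F') :
    ∃ f : E → ℝ, ContDiff ℝ ∞ f ∧ ∀ F, IsFace Δ F →
      HasUniqueCriticalMinAt f F (x F) ∧ f (x F) = α F ∧ HasNormalFormAt Δ f F (x F) := by
  classical
  obtain ⟨l, c, h⟩ := exists_isFacetFunctionals Δ
  set J : Set E → Finset (Set E) := fun F =>
    hΔ.1.finite_facets.toFinset.filter fun G => F ⊆ G with hJdef
  have hJ : ∀ F G, G ∈ J F ↔ IsFacet Δ G ∧ F ⊆ G := fun F G => by simp [hJdef]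
  choose ξ hξ using fun F : Set E => exists_injOn_coordinates (affineSpan ℝ F).direction
  set 𝓕 := hΔ.1.finite_faces.toFinset with h𝓕
  have hmem : ∀ F, F ∈ 𝓕 ↔ IsFace Δ F := fun F => by simp [h𝓕]
  have hΔface : IsFace Δ Δ := ⟨hΔ.1.nonempty, IsExposed.refl Δ⟩
  have hsub : ∀ F, IsFace Δ F → x F ∈ F := fun F hF => intrinsicInterior_subset (hx F hF)
  obtain ⟨δ, hδ, κ, hκ, f, hf, hfF⟩ := exists_radially_increasing 𝓕 ⟨Δ, (hmem Δ).2 hΔface⟩ x α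
    (fun F q => ∑ j, ξ F (q - x F) j ^ 2) (fun F q => ∑ G ∈ J F, (c G - l G q))
    (fun F hF => ((hmem F).1 hF).2.isCompact hΔ.1.isCompact)
    (fun F hF => hsub F ((hmem F).1 hF))
    (fun F hF F' hF' hne => (hmem _).2 (((hmem F).1 hF).inter ((hmem F').1 hF') hne))
    (by
      intro F hF F' hF' hss hxF
      obtain ⟨m, d, hle, hm⟩ := ((hmem F).1 hF).exists_support
      refine hss.2 fun q hq => (hm q).2 ⟨((hmem F').1 hF').subset hq, ?_⟩
      exact eq_of_mem_intrinsicInterior (fun y hy => hle y (((hmem F').1 hF').subset hy))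
        (hx F' ((hmem F').1 hF')) ((hm _).1 hxF).2 hq)
    (fun F hF F' hF' hss => hα F F' ((hmem F).1 hF) ((hmem F').1 hF') hss)
    (fun F _ => contDiff_sum_sq (ξ F) (x F))
    (fun F _ => ContDiff.sum fun G _ => contDiff_const.sub (l G).contDiff)
    (by intro F _; simp)
    (fun F _ q => Finset.sum_nonneg fun j _ => sq_nonneg _)
    (by
      intro F hF q hq hqx
      rw [fderiv_sum_sq]
      refine mul_pos two_pos (lt_of_le_of_ne (Finset.sum_nonneg fun j _ => sq_nonneg _) ?_)
      intro h0
      refine hqx (sub_eq_zero.1 (hξ F _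
        (sub_mem_direction_affineSpan hq (hsub F ((hmem F).1 hF))) (funext fun j => ?_)))
      exact pow_eq_zero_iff two_ne_zero |>.1
        ((Finset.sum_eq_zero_iff_of_nonneg fun j _ => sq_nonneg _).1 h0.symm j
          (Finset.mem_univ j)))
    (by
      intro F hF q hq
      refine Finset.sum_eq_zero fun G hG => ?_
      rw [((h.mem_iff G ((hJ F G).1 hG).1 q).1 (((hJ F G).1 hG).2 hq)).2, sub_self])
    (by
      intro F hF F' hF' q hq hqF
      have hqΔ := ((hmem F').1 hF').subset hq
      have hnn : ∀ G ∈ J F, 0 ≤ c G - l G q := fun G hG =>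
        sub_nonneg.2 (h.le G ((hJ F G).1 hG).1 q hqΔ)
      refine lt_of_le_of_ne (Finset.sum_nonneg hnn) fun h0 => hqF ?_
      refine h.mem_face hΔ.1 hdim ((hmem F).1 hF) hqΔ fun G hG hFG => ?_
      have := (Finset.sum_eq_zero_iff_of_nonneg hnn).1 h0.symm G ((hJ F G).2 ⟨hG, hFG⟩)
      linarith)
    (by
      intro F hF F' hF' hne q hq
      -- The only use of simplicity in verifying the gluing hypotheses: the extra facets through `F
      -- ∩ F'` contain `F'`, so their terms vanish at `q`.
      refine (Finset.sum_subset (fun G hG => ?_) fun G hG hGF => ?_).symm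
      · exact (hJ _ G).2 ⟨((hJ F G).1 hG).1, inter_subset_left.trans ((hJ F G).1 hG).2⟩
      · obtain ⟨hGf, hGs⟩ := (hJ _ G).1 hG
        have hF'G := (h.subset_or_subset hΔ hdim ((hmem F).1 hF) ((hmem F').1 hF') hne hGf
          hGs).resolve_left fun hFG => hGF ((hJ F G).2 ⟨hGf, hFG⟩)
        rw [((h.mem_iff G hGf q).1 (hF'G hq)).2, sub_self])
    (fun F _ q p => fderiv_sum_affine l c (J F) q p)
  refine ⟨f, hf, fun F hF => ?_⟩
  obtain ⟨hrad, hloc⟩ := hfF F ((hmem F).2 hF)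
  refine ⟨hasUniqueCriticalMinAt_of_radial (hF.2.convex hΔ.1.convex)
    (hf.differentiable (by simp)) (hx F hF) hrad, ?_,
    h.hasNormalFormAt hΔ hdim hF (hJ F) (hx F hF) (ξ F) (hξ F) hδ hκ hloc⟩
  rw [hloc.eq_of_nhds, Finset.sum_eq_zero (s := J F) fun G hG => by
    rw [((h.mem_iff G ((hJ F G).1 hG).1 _).1 (((hJ F G).1 hG).2 (hsub F hF))).2, sub_self]]
  simp

/-- A proper face has smaller dimension. -/
theorem IsFace.affDim_lt {F F' : Set E} (hF : IsFace Δ F) (hF' : IsFace Δ F') (hss : F' ⊂ F) :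
    affDim F' < affDim F := by
  obtain ⟨m, d, -, hm⟩ := hF'.exists_support
  rw [affDim, affDim, direction_affineSpan, direction_affineSpan]
  refine Submodule.finrank_lt_finrank_of_lt
    (lt_of_le_of_ne (vectorSpan_mono ℝ hss.1) fun heq => hss.2 fun q hq => ?_)
  obtain ⟨p, hp⟩ := hF'.1
  have h1 : q - p ∈ vectorSpan ℝ F' := heq ▸ vsub_mem_vectorSpan ℝ hq (hss.1 hp)
  have h2 := vectorSpan_le_ker (fun y hy => ((hm y).1 hy).2) h1
  rw [LinearMap.mem_ker, map_sub, sub_eq_zero] at h2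
  exact (hm q).2 ⟨hF.subset hq, h2.trans ((hm p).1 hp).2⟩

end Assembly

theorem mainTheorem7 {n : ℕ} (Δ : Set (EuclideanSpace ℝ (Fin n)))
    (hΔ : IsSimplePolytope Δ) (hdim : affDim Δ = n) :
    (∃ (f : EuclideanSpace ℝ (Fin n) → ℝ)
        (x : Set (EuclideanSpace ℝ (Fin n)) → EuclideanSpace ℝ (Fin n)),
      IsSmoothOnSet f Δ ∧
      ∀ F, IsFace Δ F → HasUniqueCriticalMinAt f F (x F) ∧ HasNormalFormAt Δ f F (x F)) ∧
    (∀ (x : Set (EuclideanSpace ℝ (Fin n)) → EuclideanSpace ℝ (Fin n))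
        (α : Set (EuclideanSpace ℝ (Fin n)) → ℝ),
      (∀ F, IsFace Δ F → x F ∈ intrinsicInterior ℝ F) →
      (∀ F, IsFace Δ F → 0 ≤ α F) →
      (∀ F F', IsFace Δ F → IsFace Δ F' → F' ⊂ F → α F < α F') →
      ∃ f : EuclideanSpace ℝ (Fin n) → ℝ,
        IsSmoothOnSet f Δ ∧
        ∀ F, IsFace Δ F →
          HasUniqueCriticalMinAt f F (x F) ∧ f (x F) = α F ∧ HasNormalFormAt Δ f F (x F)) := by
  have hdim' : affDim Δ = Module.finrank ℝ (EuclideanSpace ℝ (Fin n)) := by simpa using hdim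
  constructor
  · have hex : ∀ F : Set (EuclideanSpace ℝ (Fin n)), ∃ p, IsFace Δ F →
        p ∈ intrinsicInterior ℝ F := by
      intro F
      by_cases hF : IsFace Δ F
      · obtain ⟨p, hp⟩ := hF.1.intrinsicInterior (hF.2.convex hΔ.1.convex)
        exact ⟨p, fun _ => hp⟩
      · exact ⟨0, fun h => absurd h hF⟩
    choose x hx using hex
    -- Without prescribed values, minus the dimension is a choice that increases strictly on passing
    -- to a proper subface.
    obtain ⟨f, hf, hfF⟩ := exists_function_on_simplePolytope hΔ hdim' x
      (fun F => -(affDim F : ℝ)) hx fun F F' hF hF' hss => by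
        simpa using hF.affDim_lt hF' hss
    exact ⟨f, x, hf.isSmoothOnSet Δ, fun F hF => ⟨(hfF F hF).1, (hfF F hF).2.2⟩⟩
  · intro x α hx _ hα
    obtain ⟨f, hf, hfF⟩ := exists_function_on_simplePolytope hΔ hdim' x α hx hα
    exact ⟨f, hf.isSmoothOnSet Δ, hfF⟩
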